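/- A set $N$ is an $\epsilon$-net, with respect to a family $\mathcal S$ of subsets of the plane, of a finite point set $P\subset\mathbb R^2$ if $N\subseteq P$ and $N\cap S\neq\emptyset$ for every $S\in\mathcal S$ with $|S\cap P|>\epsilon|P|$. Let $\epsilon_i^{\mathcal S}$ be the smallest $\epsilon\in[0,1]$ such that every finite set $P\subset\mathbb R^2$ with at least $i$ points has an $\epsilon$-net of size $i$ with respect to $\mathcal S$. Let $\mathcal D$ be the family of disks in the plane. A centerpoint of $P$ is a point $p\in\mathbb R^2$ such that every closed halfplane containing $p$ contains at least $|P|/3$ points of $P$. A Delaunay triangle of $P$ is a nondegenerate triangle with vertices in $P$ whose circumcircle has no point of $P$ in its interior. **Theorem.** $\epsilon_2^{\mathcal D}\le \frac23$. Moreover, let $P$ be a finite set of $n$ points in the plane, not all on one line. Then $P$ has a centerpoint, every centerpoint of $P$ lies in some (closed) Delaunay triangle of $P$, and for every centerpoint $p$ of $P$ and every Delaunay triangle $abc$ of $P$ that contains $p$: 1. one of the three edges of $abc$ is met by at least $\frac{n-3}{3}$ of the $n-3$ segments $pq$, $q\in P\setminus\{a,b,c\}$; 2. the two endpoints of any edge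 of $abc$ that is met by at least $\frac{n-3}{3}$ of these segments form a $\frac23$-net of $P$ with respect to $\mathcal D$. -/

import Mathlib

/-- `N` is a (strong) `ε`-net of the finite point set `P` with respect to the family `𝓡`:
`N ⊆ P`, and `N` meets every member of `𝓡` that has more than `ε * |P|` points of `P`. -/
def IsStrongNet {α : Type*} (ε : ℝ) (P : Finset α) (𝓡 : Set (Set α)) (N : Set α) : Prop :=
  N ⊆ (P : Set α) ∧
    ∀ R ∈ 𝓡, ε * (P.card : ℝ) < ((R ∩ (P : Set α)).ncard : ℝ) → (N ∩ R).Nonempty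

/-- The set of all `ε ∈ [0, 1]` such that every finite point set (with at least `i` points, so that
it has subsets of size `i` at all) has an `ε`-net of size `i` with respect to `𝓢`. -/
def netBounds {α : Type*} (𝓢 : Set (Set α)) (i : ℕ) : Set ℝ :=
  {ε | ε ∈ Set.Icc (0 : ℝ) 1 ∧ ∀ P : Finset α, i ≤ P.card →
    ∃ Q : Finset α, Q ⊆ P ∧ Q.card = i ∧ IsStrongNet ε P 𝓢 (Q : Set α)}

/-- The constant `ε_i^𝓢`: the smallest element of `netBounds 𝓢 i`
(it exists by `isLeast_epsilonConst`). -/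
noncomputable def epsilonConst {α : Type*} (𝓢 : Set (Set α)) (i : ℕ) : ℝ :=
  sInf (netBounds 𝓢 i)

/-- `epsilonConst 𝓢 i` is the minimum of `netBounds 𝓢 i`, not a junk value. -/
theorem isLeast_epsilonConst {α : Type*} (𝓢 : Set (Set α)) (i : ℕ) :
    IsLeast (netBounds 𝓢 i) (epsilonConst 𝓢 i) := by
  have hbdd : BddBelow (netBounds 𝓢 i) := ⟨0, fun ε hε => hε.1.1⟩
  have hone : (1 : ℝ) ∈ netBounds 𝓢 i := by
    refine ⟨by simp, fun P hP => ?_⟩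
    obtain ⟨Q, hQ, hc⟩ := Finset.exists_subset_card_eq hP
    refine ⟨Q, hQ, hc, by exact_mod_cast hQ, fun R _ h => ?_⟩
    have h1 : (R ∩ (P : Set α)).ncard ≤ (P : Set α).ncard :=
      Set.ncard_le_ncard Set.inter_subset_right P.finite_toSet
    rw [Set.ncard_coe_finset] at h1
    have h2 : ((R ∩ (P : Set α)).ncard : ℝ) ≤ P.card := by exact_mod_cast h1
    linarith
  have hne : (netBounds 𝓢 i).Nonempty := ⟨1, hone⟩
  have h0 : 0 ≤ epsilonConst 𝓢 i := le_csInf hne fun ε hε => hε.1.1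
  refine ⟨⟨⟨h0, csInf_le hbdd hone⟩, fun P hP => ?_⟩, fun ε hε => csInf_le hbdd hε⟩
  set e := epsilonConst 𝓢 i with he
  have key : ∃ ε' ∈ netBounds 𝓢 i, ε' * (P.card : ℝ) < (⌊e * (P.card : ℝ)⌋₊ : ℝ) + 1 := by
    rcases Nat.eq_zero_or_pos P.card with h | h
    · exact ⟨1, hone, by simp [h]⟩
    · have hp : (0 : ℝ) < P.card := by exact_mod_cast h
      have hlt : sInf (netBounds 𝓢 i) < ((⌊e * (P.card : ℝ)⌋₊ : ℝ) + 1) / P.card := by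
        rw [lt_div_iff₀ hp]
        exact Nat.lt_floor_add_one (e * (P.card : ℝ))
      obtain ⟨ε', h1, h2⟩ := exists_lt_of_csInf_lt hne hlt
      exact ⟨ε', h1, (lt_div_iff₀ hp).1 h2⟩
  obtain ⟨ε', h1, h2⟩ := key
  obtain ⟨Q, hQ, hc, hs, hnet⟩ := h1.2 P hP
  refine ⟨Q, hQ, hc, hs, fun R hR h => hnet R hR (h2.trans_le ?_)⟩
  have h3 : ⌊e * (P.card : ℝ)⌋₊ < (R ∩ (P : Set α)).ncard :=
    (Nat.floor_lt (mul_nonneg h0 (Nat.cast_nonneg _))).2 h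
  exact_mod_cast h3

/-- The Euclidean plane. -/
abbrev Plane : Type := EuclideanSpace ℝ (Fin 2)

/-- The family of (closed, nondegenerate) disks in the plane. -/
def disks : Set (Set Plane) :=
  {D | ∃ (o : Plane) (r : ℝ), 0 < r ∧ D = Metric.closedBall o r}

/-- `x` is a centerpoint of `P ⊆ ℝ^d`: every halfspace `{y | t ≤ ⟪v, y⟫}` (with `v ≠ 0`) that
contains `x` contains at least `|P| / (d + 1)` points of `P`. -/
def IsCenterpoint {d : ℕ} (P : Finset (EuclideanSpace ℝ (Fin d)))
    (x : EuclideanSpace ℝ (Fin d)) : Prop :=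
  ∀ (v : EuclideanSpace ℝ (Fin d)) (t : ℝ), v ≠ 0 → t ≤ inner ℝ v x →
    (P.card : ℝ) / ((d : ℝ) + 1) ≤ (({y | t ≤ inner ℝ v y} ∩ (P : Set _)).ncard : ℝ)

/-- `T` is a Delaunay triangle of `P`: a nondegenerate triangle with vertices in `P` whose
circumcircle has no point of `P` in its interior. -/
def IsDelaunayTriangle (P : Finset Plane) (T : Affine.Triangle ℝ Plane) : Prop :=
  (∀ k, T.points k ∈ P) ∧ ∀ q ∈ P, T.circumradius ≤ dist q T.circumcenter

/-- The points `q` of `P`, other than the vertices of `T`, for which the segment `pq` meets the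
edge of `T` that joins the vertices number `i` and `j`. -/
def crossingPoints (P : Finset Plane) (T : Affine.Triangle ℝ Plane) (p : Plane)
    (i j : Fin 3) : Set Plane :=
  {q | q ∈ P ∧ q ∉ Set.range T.points ∧
    (segment ℝ p q ∩ segment ℝ (T.points i) (T.points j)).Nonempty}

/-! The key is the radical axis. Let a disk D avoid both ends of a heavily crossed edge of a
Delaunay triangle containing the centerpoint p. If D contains no crossing q, it misses these points
and both ends, more than n/3 points. Otherwise let g be the power with respect to D minus the power
with respect to the circumcircle, an affine function. It is at most 0 on P ∩ D, because no point of
P is inside the circumcircle, and positive at both ends of the edge, so also where pq crosses it; as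
g(q) ≤ 0, also g(p) > 0. A closed halfplane bounded by a line through p thus avoids P ∩ D and holds
at least n/3 points.

Every segment pq meets an edge, since q is not inside the circumcircle, so pigeonhole gives the
heavy edge. Centerpoints come from Helly's theorem. Delaunay triangles cover the hull: for generic
x, a triangle containing x whose circumcircle gives x the largest power is Delaunay, by a
simplex-method exchange; a limit handles the remaining points. For collinear P, a median suffices.
-/

theorem dist_sq_sub_dist_sq {E : Type*} [NormedAddCommGroup E] [InnerProductSpace ℝ E]
    (x o o' : E) :
    dist x o ^ 2 - dist x o' ^ 2 = 2 * inner ℝ (o' - o) x + (‖o‖ ^ 2 - ‖o'‖ ^ 2) := by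
  rw [dist_eq_norm, dist_eq_norm, norm_sub_sq_real, norm_sub_sq_real, inner_sub_left,
    real_inner_comm x o, real_inner_comm x o']
  ring

/-- Moving from a point with nonnegative coordinates to one with a nonpositive coordinate, one
passes through a point with nonnegative coordinates one of which vanishes. -/
theorem exists_first_exit {ι : Type*} [Fintype ι] (l m : ι → ℝ) (hl : ∀ i, 0 ≤ l i)
    (hm : ∃ i, m i ≤ 0) :
    ∃ s ∈ Set.Icc (0 : ℝ) 1, ∃ i, (1 - s) * l i + s * m i = 0 ∧
      ∀ j, 0 ≤ (1 - s) * l j + s * m j := by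
  classical
  obtain ⟨i₀, hi₀⟩ := hm
  -- The ratio is the time at which coordinate `i` vanishes. A zero denominator forces `l i = m i =
  -- 0`, and the default value 0 is then right.
  obtain ⟨i, hi, hmin⟩ := Finset.exists_min_image (Finset.univ.filter fun i => m i ≤ 0)
    (fun i => l i / (l i - m i)) ⟨i₀, by simpa using hi₀⟩
  simp only [Finset.mem_filter, Finset.mem_univ, true_and] at hi hmin
  have h0 : ∀ j, m j ≤ 0 → 0 ≤ l j - m j := fun j hj => by linarith [hl j]
  have hs0 : 0 ≤ l i / (l i - m i) := div_nonneg (hl i) (h0 i hi)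
  have hs1 : l i / (l i - m i) ≤ 1 := div_le_one_of_le₀ (by linarith) (h0 i hi)
  refine ⟨l i / (l i - m i), ⟨hs0, hs1⟩, i, ?_, fun j => ?_⟩
  · rcases (h0 i hi).eq_or_lt with h | h
    · have h1 : l i = 0 := le_antisymm (by linarith) (hl i)
      have h2 : m i = 0 := by linarith
      simp [h1, h2]
    · field_simp
      ring
  · rcases le_or_gt (m j) 0 with hj | hj
    · rcases (h0 j hj).eq_or_lt with h | h
      · have h1 : l j = 0 := le_antisymm (by linarith) (hl j)
        have h2 : m j = 0 := by linarith
        simp [h1, h2]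
      · have := (le_div_iff₀ h).1 (hmin j hj)
        linarith
    · have h1 := mul_nonneg (sub_nonneg.2 hs1) (hl j)
      have h2 := mul_nonneg hs0 hj.le
      linarith

/-- The ratio test of the simplex method. -/
theorem exists_pivot {ι : Type*} [Fintype ι] (l m : ι → ℝ) (hl : ∀ i, 0 < l i)
    (hm : ∑ i, m i = 1) :
    ∃ s, 0 < s ∧ ∃ i, l i = s * m i ∧ ∀ j, 0 ≤ l j - s * m j := by
  classical
  obtain ⟨i₀, -, hi₀⟩ : ∃ i ∈ Finset.univ, 0 < m i :=
    Finset.exists_lt_of_sum_lt (f := fun _ => 0) (by simp [hm])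
  obtain ⟨i, hi, hmin⟩ := Finset.exists_min_image (Finset.univ.filter fun i => 0 < m i)
    (fun i => l i / m i) ⟨i₀, by simpa using hi₀⟩
  simp only [Finset.mem_filter, Finset.mem_univ, true_and] at hi hmin
  have hs : 0 < l i / m i := div_pos (hl i) hi
  refine ⟨l i / m i, hs, i, by field_simp, fun j => ?_⟩
  rcases le_or_gt (m j) 0 with hj | hj
  · have := mul_nonpos_of_nonneg_of_nonpos hs.le hj
    linarith [hl j]
  · have := (le_div_iff₀ hj).1 (hmin j hj)
    linarith

/-! ### Barycentric coordinates in a triangle -/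

/-- The vertices of a triangle in the plane, as an affine basis. -/
noncomputable def Affine.Simplex.planeBasis (T : Affine.Triangle ℝ Plane) :
    AffineBasis (Fin 3) ℝ Plane :=
  ⟨T.points, T.independent, by
    rw [T.independent.affineSpan_eq_top_iff_card_eq_finrank_add_one]; simp⟩

theorem Affine.Simplex.coe_planeBasis (T : Affine.Triangle ℝ Plane) :
    (T.planeBasis : Fin 3 → Plane) = T.points := rfl

theorem Affine.Simplex.mem_convexHull_iff_coord (T : Affine.Triangle ℝ Plane) (p : Plane) :
    p ∈ convexHull ℝ (Set.range T.points) ↔ ∀ i, 0 ≤ T.planeBasis.coord i p := by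
  rw [← T.coe_planeBasis, AffineBasis.convexHull_eq_nonneg_coord]; rfl

theorem Affine.Simplex.sum_coord_smul (T : Affine.Triangle ℝ Plane) (p : Plane) :
    ∑ i, T.planeBasis.coord i p • T.points i = p :=
  T.planeBasis.linear_combination_coord_eq_self p

/-- A point that is not inside the circumcircle is not inside the triangle. -/
theorem Affine.Simplex.exists_coord_nonpos (T : Affine.Triangle ℝ Plane) {q : Plane}
    (hq : T.circumradius ≤ dist q T.circumcenter) : ∃ i, T.planeBasis.coord i q ≤ 0 := by
  by_contra! h
  have h1 : q ∈ interior (convexHull ℝ (Set.range T.planeBasis)) := by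
    rw [AffineBasis.interior_convexHull]; exact h
  have h2 : convexHull ℝ (Set.range T.planeBasis) ⊆
      Metric.closedBall T.circumcenter T.circumradius := by
    refine convexHull_min ?_ (convex_closedBall _ _)
    rintro _ ⟨i, rfl⟩
    exact (T.dist_circumcenter_eq_circumradius i).le
  have h3 := interior_mono h2 h1
  rw [interior_closedBall _ T.circumradius_pos.ne', Metric.mem_ball] at h3
  linarith

theorem Fin.sum_univ_three_cyclic {M : Type*} [AddCommMonoid M] (f : Fin 3 → M) (i : Fin 3) :
    ∑ j, f j = f i + f (i + 1) + f (i + 2) := by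
  rw [← Equiv.sum_comp (Equiv.addLeft i) f, Fin.sum_univ_three]
  simp

/-- A point of a triangle with a vanishing barycentric coordinate lies on the opposite edge. -/
theorem Affine.Simplex.mem_segment_of_coord_eq_zero (T : Affine.Triangle ℝ Plane) {x : Plane}
    (hx : ∀ i, 0 ≤ T.planeBasis.coord i x) {i : Fin 3} (hi : T.planeBasis.coord i x = 0) :
    x ∈ segment ℝ (T.points (i + 1)) (T.points (i + 2)) := by
  refine ⟨_, _, hx (i + 1), hx (i + 2), ?_, ?_⟩
  · have := T.planeBasis.sum_coord_apply_eq_one x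
    rwa [Fin.sum_univ_three_cyclic _ i, hi, zero_add] at this
  · have := T.sum_coord_smul x
    rwa [Fin.sum_univ_three_cyclic _ i, hi, zero_smul, zero_add] at this

/-- A segment from a triangle to a point that is not inside its circumcircle meets an edge. -/
theorem Affine.Simplex.exists_segment_inter_edge (T : Affine.Triangle ℝ Plane) {p q : Plane}
    (hp : p ∈ convexHull ℝ (Set.range T.points)) (hq : T.circumradius ≤ dist q T.circumcenter) :
    ∃ i : Fin 3,
      (segment ℝ p q ∩ segment ℝ (T.points (i + 1)) (T.points (i + 2))).Nonempty := by
  obtain ⟨s, hs, i, hi, hnn⟩ := exists_first_exit (fun i => T.planeBasis.coord i p)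
    (fun i => T.planeBasis.coord i q) ((T.mem_convexHull_iff_coord p).1 hp)
    (T.exists_coord_nonpos hq)
  have hc : ∀ j, T.planeBasis.coord j (AffineMap.lineMap p q s) =
      (1 - s) * T.planeBasis.coord j p + s * T.planeBasis.coord j q := fun j => by
    rw [AffineMap.apply_lineMap, AffineMap.lineMap_apply_ring]
  refine ⟨i, AffineMap.lineMap p q s, ?_, T.mem_segment_of_coord_eq_zero ?_ ?_⟩
  · rw [segment_eq_image_lineMap]; exact ⟨s, hs, rfl⟩
  · intro j; rw [hc]; exact hnn j
  · rw [hc]; exact hi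

/-! ### Centerpoints -/

theorem IsCenterpoint.mem_convexHull {d : ℕ} {P : Finset (EuclideanSpace ℝ (Fin d))}
    {x : EuclideanSpace ℝ (Fin d)} (hx : IsCenterpoint P x) (hP : P.Nonempty) :
    x ∈ convexHull ℝ (P : Set (EuclideanSpace ℝ (Fin d))) := by
  by_contra hcon
  obtain ⟨f, u, hf, hu⟩ := geometric_hahn_banach_closed_point (convex_convexHull ℝ _)
    (P.finite_toSet.isClosed_convexHull ℝ) hcon
  obtain ⟨v, rfl⟩ := (InnerProductSpace.toDual ℝ (EuclideanSpace ℝ (Fin d))).surjective f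
  simp only [InnerProductSpace.toDual_apply_apply] at hf hu
  obtain ⟨y, hy⟩ := hP
  have hv : v ≠ 0 := by
    rintro rfl
    have := hf y (subset_convexHull ℝ _ hy)
    simp only [inner_zero_left] at this hu
    linarith
  have h := hx v u hv hu.le
  have hempty : {y | u ≤ inner ℝ v y} ∩ (P : Set (EuclideanSpace ℝ (Fin d))) = ∅ := by
    ext z
    simp only [Set.mem_inter_iff, Set.mem_ofPred_eq, Set.mem_empty_iff_false, iff_false, not_and]
    exact fun hz hzP => not_lt.2 hz (hf z (subset_convexHull ℝ _ hzP))
  rw [hempty, Set.ncard_empty, Nat.cast_zero] at h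
  have hc : (0 : ℝ) < P.card := by exact_mod_cast Finset.card_pos.2 ⟨y, hy⟩
  have : (0 : ℝ) < P.card / ((d : ℝ) + 1) := by positivity
  linarith

/-- The **centerpoint theorem**. -/
theorem exists_isCenterpoint {d : ℕ} {P : Finset (EuclideanSpace ℝ (Fin d))} (hP : P.Nonempty) :
    ∃ x, IsCenterpoint P x := by
  classical
  -- Members of `F` omit fewer than n/(d+1) points, so d+1 of them cannot together omit all of `P`:
  -- Helly applies.
  let F : Finset (Finset (EuclideanSpace ℝ (Fin d))) :=
    P.powerset.filter fun S => (d + 1) * (P \ S).card < P.card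
  have hne : (⋂ S ∈ F, convexHull ℝ (S : Set (EuclideanSpace ℝ (Fin d)))).Nonempty := by
    refine Convex.helly_theorem' (𝕜 := ℝ) (fun S _ => convex_convexHull ℝ _) fun I hI hcard => ?_
    rw [finrank_euclideanSpace_fin] at hcard
    have hlt : (I.biUnion fun S => P \ S).card < P.card := by
      rcases I.eq_empty_or_nonempty with rfl | hIne
      · simpa using hP
      refine lt_of_mul_lt_mul_left (a := d + 1) ?_ (Nat.zero_le _)
      calc (d + 1) * (I.biUnion fun S => P \ S).card
          ≤ (d + 1) * ∑ S ∈ I, (P \ S).card := Nat.mul_le_mul_left _ Finset.card_biUnion_le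
        _ = ∑ S ∈ I, (d + 1) * (P \ S).card := Finset.mul_sum ..
        _ < ∑ S ∈ I, P.card :=
          Finset.sum_lt_sum_of_nonempty hIne fun S hS => (Finset.mem_filter.1 (hI hS)).2
        _ = I.card * P.card := by simp
        _ ≤ (d + 1) * P.card := Nat.mul_le_mul_right _ hcard
    obtain ⟨x, hxP, hx⟩ := Finset.exists_mem_notMem_of_card_lt_card hlt
    refine ⟨x, Set.mem_iInter₂.2 fun S hS => subset_convexHull ℝ _ ?_⟩
    by_contra hxS
    exact hx (Finset.mem_biUnion.2 ⟨S, hS, Finset.mem_sdiff.2 ⟨hxP, hxS⟩⟩)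
  obtain ⟨x, hx⟩ := hne
  rw [Set.mem_iInter₂] at hx
  refine ⟨x, fun v t _ ht => ?_⟩
  by_contra! hlt
  set H := P.filter fun y => t ≤ inner ℝ v y with hH
  have hHc : {y | t ≤ inner ℝ v y} ∩ (P : Set (EuclideanSpace ℝ (Fin d))) = (H : Set _) := by
    ext y; simp [hH, and_comm]
  rw [hHc, Set.ncard_coe_finset, lt_div_iff₀ (by positivity)] at hlt
  have hS : P \ H ∈ F := by
    refine Finset.mem_filter.2 ⟨Finset.mem_powerset.2 Finset.sdiff_subset, ?_⟩
    rw [Finset.sdiff_sdiff_eq_self (Finset.filter_subset _ _), mul_comm]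
    exact_mod_cast hlt
  have hsub : convexHull ℝ ((P \ H : Finset _) : Set (EuclideanSpace ℝ (Fin d))) ⊆
      {y | inner ℝ v y < t} := by
    refine convexHull_min (fun y hy => ?_)
      (convex_halfSpace_lt (innerₛₗ ℝ v).isLinear t)
    simp only [hH, Finset.coe_sdiff, Set.mem_sdiff, Finset.mem_coe, Finset.mem_filter, not_and,
      not_le] at hy
    exact hy.2 hy.1
  exact not_lt.2 ht (hsub (hx _ hS))

/-! ### Delaunay triangles cover the convex hull -/

/-- `x` lies on no line through two points of `P`. -/
def AvoidsCollinearSpans (P : Finset Plane) (x : Plane) : Prop :=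
  ∀ S ⊆ P, Collinear ℝ (S : Set Plane) → x ∉ affineSpan ℝ (S : Set Plane)

theorem affineSpan_eq_top_of_not_collinear {S : Set Plane} (hS : ¬ Collinear ℝ S) :
    affineSpan ℝ S = ⊤ := by
  have hne : S.Nonempty := by
    rw [Set.nonempty_iff_ne_empty]; rintro rfl; exact hS (collinear_empty ℝ _)
  rw [AffineSubspace.affineSpan_eq_top_iff_vectorSpan_eq_top_of_nonempty ℝ _ _ hne]
  rw [collinear_iff_finrank_le_one] at hS
  refine Submodule.eq_top_of_finrank_eq (le_antisymm (Submodule.finrank_le _) ?_)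
  rw [finrank_euclideanSpace_fin]
  omega

theorem Collinear.affineSpan_ne_top {S : Set Plane} (hS : Collinear ℝ S) :
    affineSpan ℝ S ≠ ⊤ := by
  intro h
  have h1 := AffineSubspace.vectorSpan_eq_top_of_affineSpan_eq_top ℝ _ _ h
  rw [collinear_iff_finrank_le_one, h1, finrank_top, finrank_euclideanSpace_fin] at hS
  omega

/-- The hull has positive area, while finitely many proper affine subspaces have measure zero. -/
theorem exists_avoidsCollinearSpans {P : Finset Plane} (hP : ¬ Collinear ℝ (P : Set Plane)) :
    ∃ c ∈ convexHull ℝ (P : Set Plane), AvoidsCollinearSpans P c := by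
  classical
  have hpos : 0 < MeasureTheory.volume (convexHull ℝ (P : Set Plane)) :=
    MeasureTheory.Measure.measure_pos_of_nonempty_interior _
      (interior_convexHull_nonempty_iff_affineSpan_eq_top.2
        (affineSpan_eq_top_of_not_collinear hP))
  have hzero : MeasureTheory.volume (⋃ S ∈ P.powerset.filter fun S : Finset Plane => Collinear ℝ (S : Set Plane),
      (affineSpan ℝ (S : Set Plane) : Set Plane)) = 0 := by
    refine (MeasureTheory.measure_biUnion_null_iff (Finset.countable_toSet _)).2 fun S hS => ?_
    exact MeasureTheory.Measure.addHaar_affineSubspace _ _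
      (Finset.mem_filter.1 hS).2.affineSpan_ne_top
  obtain ⟨c, hc, hc'⟩ := Set.not_subset.1 fun hsub =>
    hpos.ne' (MeasureTheory.measure_mono_null hsub hzero)
  refine ⟨c, hc, fun S hS hcol hcS => hc' ?_⟩
  exact Set.mem_iUnion₂.2 ⟨S, Finset.mem_filter.2 ⟨Finset.mem_powerset.2 hS, hcol⟩, hcS⟩

open Filter Topology in
theorem AvoidsCollinearSpans.eventually_lineMap {P : Finset Plane} {c : Plane}
    (hc : AvoidsCollinearSpans P c) (p : Plane) :
    ∀ᶠ s in 𝓝[>] (0 : ℝ), AvoidsCollinearSpans P (AffineMap.lineMap p c s) := by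
  classical
  have h : ∀ S ∈ P.powerset, ∀ᶠ s in 𝓝[>] (0 : ℝ), Collinear ℝ (S : Set Plane) →
      AffineMap.lineMap p c s ∉ affineSpan ℝ (S : Set Plane) := by
    intro S hS
    by_cases hcol : Collinear ℝ (S : Set Plane)
    swap
    · exact Eventually.of_forall fun _ h => absurd h hcol
    have hcS := hc S (Finset.mem_powerset.1 hS) hcol
    have hsub : {s : ℝ | AffineMap.lineMap p c s ∈ affineSpan ℝ (S : Set Plane)}.Subsingleton := by
      intro s hs t ht
      by_contra hst
      -- Two parameters in the span would put `c`, the point at parameter 1, there too.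
      have h1 := AffineMap.lineMap_mem (Q := affineSpan ℝ (S : Set Plane))
        ((1 - s) / (t - s)) hs ht
      have hts : t - s ≠ 0 := sub_ne_zero.2 (Ne.symm hst)
      have h2 : AffineMap.lineMap (AffineMap.lineMap p c s) (AffineMap.lineMap p c t)
          ((1 - s) / (t - s)) = c := by
        rw [← AffineMap.apply_lineMap, AffineMap.lineMap_apply_ring']
        rw [div_mul_cancel₀ _ hts, sub_add_cancel, AffineMap.lineMap_apply_one]
      rw [h2] at h1
      exact hcS h1
    have hle : 𝓝[>] (0 : ℝ) ≤ cofinite :=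
      (nhdsWithin_mono _ fun x hx => ne_of_gt hx).trans (nhdsNE_le_cofinite 0)
    filter_upwards [hle hsub.finite.compl_mem_cofinite] with s hs _ using hs
  filter_upwards [(eventually_all_finset P.powerset).2 h] with s hs S hS hcol
  exact hs S (Finset.mem_powerset.2 hS) hcol

theorem sum_mul_dist_sq_sub_dist_sq {E ι : Type*} [NormedAddCommGroup E] [InnerProductSpace ℝ E]
    [Fintype ι] {w : ι → ℝ} {z : ι → E} {x : E} (hw : ∑ i, w i = 1) (hx : ∑ i, w i • z i = x)
    (o o' : E) :
    ∑ i, w i * (dist (z i) o ^ 2 - dist (z i) o' ^ 2) = dist x o ^ 2 - dist x o' ^ 2 := by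
  simp_rw [dist_sq_sub_dist_sq, mul_add, Finset.sum_add_distrib, ← Finset.sum_mul, hw, one_mul]
  rw [← hx, inner_sum, Finset.mul_sum]
  simp_rw [inner_smul_right]
  congr 1
  exact Finset.sum_congr rfl fun i _ => by ring

theorem AvoidsCollinearSpans.not_collinear {P : Finset Plane} {x : Plane}
    (hx : AvoidsCollinearSpans P x) {S : Set Plane} (hS : S ⊆ P)
    (hxS : x ∈ convexHull ℝ S) : ¬ Collinear ℝ S := by
  classical
  intro hcol
  lift S to Finset Plane using P.finite_toSet.subset hS
  exact hx S (by exact_mod_cast hS) hcol (convexHull_subset_affineSpan _ hxS)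

/-- Carathéodory gives affinely independent points; genericity of `x` forces exactly three. -/
theorem AvoidsCollinearSpans.exists_triangle {P : Finset Plane} {x : Plane}
    (hx : AvoidsCollinearSpans P x) (hconv : x ∈ convexHull ℝ (P : Set Plane)) :
    ∃ T : Affine.Triangle ℝ Plane, (∀ k, T.points k ∈ P) ∧
      x ∈ convexHull ℝ (Set.range T.points) := by
  obtain ⟨ι, _, z, w, hz, hind, hw, hw1, hwx⟩ := eq_pos_convex_span_of_mem_convexHull hconv
  have hxz : x ∈ convexHull ℝ (Set.range z) :=
    mem_convexHull_of_exists_fintype w z (fun i => (hw i).le) hw1 (fun i => ⟨i, rfl⟩) hwx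
  have hnc := hx.not_collinear hz hxz
  have hcard : Fintype.card ι = 3 := by
    have := hind.affineSpan_eq_top_iff_card_eq_finrank_add_one.1
      (affineSpan_eq_top_of_not_collinear hnc)
    rwa [finrank_euclideanSpace_fin] at this
  let e : Fin 3 ≃ ι := (Fintype.equivFinOfCardEq hcard).symm
  refine ⟨⟨z ∘ e, hind.comp_embedding e.toEmbedding⟩, fun k => hz ⟨e k, rfl⟩, ?_⟩
  simpa only [e.surjective.range_comp] using hxz

theorem AvoidsCollinearSpans.coord_pos {P : Finset Plane} {x : Plane}
    (hx : AvoidsCollinearSpans P x) {T : Affine.Triangle ℝ Plane} (hT : ∀ k, T.points k ∈ P)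
    (hxT : x ∈ convexHull ℝ (Set.range T.points)) (i : Fin 3) : 0 < T.planeBasis.coord i x := by
  rw [T.mem_convexHull_iff_coord] at hxT
  refine (hxT i).lt_of_ne' fun h0 => ?_
  have h := T.mem_segment_of_coord_eq_zero hxT h0
  rw [← convexHull_pair] at h
  refine hx.not_collinear ?_ h (collinear_pair ℝ _ _)
  rintro y (rfl | rfl)
  · exact hT _
  · exact hT _

/-- Replacing a vertex by a point inside the circumcircle increases the power of `x`. -/
theorem AvoidsCollinearSpans.exists_triangle_power_lt {P : Finset Plane} {x : Plane}
    (hx : AvoidsCollinearSpans P x) {T : Affine.Triangle ℝ Plane} (hT : ∀ k, T.points k ∈ P)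
    (hxT : x ∈ convexHull ℝ (Set.range T.points)) {q : Plane} (hqP : q ∈ P)
    (hq : dist q T.circumcenter < T.circumradius) :
    ∃ T' : Affine.Triangle ℝ Plane, (∀ k, T'.points k ∈ P) ∧
      x ∈ convexHull ℝ (Set.range T'.points) ∧
      dist x T.circumcenter ^ 2 - T.circumradius ^ 2 <
        dist x T'.circumcenter ^ 2 - T'.circumradius ^ 2 := by
  obtain ⟨s, hs, i, hi, hnn⟩ := exists_pivot (fun i => T.planeBasis.coord i x)
    (fun i => T.planeBasis.coord i q) (hx.coord_pos hT hxT) (T.planeBasis.sum_coord_apply_eq_one q)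
  have h1 : i + 1 ≠ i := by simp
  have h2 : i + 2 ≠ i := by simp
  -- Subtracting `s` times the coordinates of `q` kills the weight of vertex `i`; `q` takes its
  -- place with weight `s`.
  let w : Fin 3 → ℝ :=
    Function.update (fun j => T.planeBasis.coord j x - s * T.planeBasis.coord j q) i s
  let t : Fin 3 → Plane := Function.update T.points i q
  have hw : ∑ j, w j = 1 := by
    have e1 := T.planeBasis.sum_coord_apply_eq_one x
    have e2 := T.planeBasis.sum_coord_apply_eq_one q
    rw [Fin.sum_univ_three_cyclic _ i] at e1 e2 ⊢
    simp only [w, Function.update_self, Function.update_of_ne h1, Function.update_of_ne h2]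
    linear_combination e1 - s * e2 - hi
  have hwx : ∑ j, w j • t j = x := by
    have e1 := T.sum_coord_smul x
    have e2 := T.sum_coord_smul q
    rw [Fin.sum_univ_three_cyclic _ i] at e1 e2 ⊢
    simp only [w, t, Function.update_self, Function.update_of_ne h1, Function.update_of_ne h2]
    have hi' : T.planeBasis.coord i x • T.points i = (s * T.planeBasis.coord i q) • T.points i :=
      congrArg (· • T.points i) hi
    linear_combination (norm := module) e1 - s • e2 - hi'
  have hw0 : ∀ j, 0 ≤ w j := fun j => by
    rcases eq_or_ne j i with rfl | hj
    · simpa [w] using hs.le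
    · simpa only [w, Function.update_of_ne hj] using hnn j
  have htP : ∀ j, t j ∈ P := fun j => by
    rcases eq_or_ne j i with rfl | hj
    · simpa [t] using hqP
    · simpa only [t, Function.update_of_ne hj] using hT j
  have hxt : x ∈ convexHull ℝ (Set.range t) :=
    mem_convexHull_of_exists_fintype w t hw0 hw (fun j => ⟨j, rfl⟩) hwx
  have hind : AffineIndependent ℝ t := by
    rw [affineIndependent_iff_not_collinear]
    refine hx.not_collinear ?_ hxt
    rintro _ ⟨j, rfl⟩
    exact htP j
  let T' : Affine.Triangle ℝ Plane := ⟨t, hind⟩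
  refine ⟨T', htP, hxt, ?_⟩
  -- All new vertices have power 0 for the new circle; for the old one only `q` has nonzero power.
  -- So the power of `x` grows by `s` times minus the old power of `q`.
  have key := sum_mul_dist_sq_sub_dist_sq hw hwx T'.circumcenter T.circumcenter
  have hT' : ∀ j, dist (t j) T'.circumcenter = T'.circumradius :=
    T'.dist_circumcenter_eq_circumradius
  have hwi : w i = s := Function.update_self ..
  have hti : t i = q := Function.update_self ..
  have ht1 : t (i + 1) = T.points (i + 1) := Function.update_of_ne h1 ..
  have ht2 : t (i + 2) = T.points (i + 2) := Function.update_of_ne h2 ..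
  simp only [hT'] at key
  rw [Fin.sum_univ_three_cyclic _ i] at hw key
  rw [hwi] at hw
  rw [hwi, hti, ht1, ht2, T.dist_circumcenter_eq_circumradius,
    T.dist_circumcenter_eq_circumradius] at key
  have hlt : 0 < s * (T.circumradius ^ 2 - dist q T.circumcenter ^ 2) :=
    mul_pos hs (sub_pos.2 (pow_lt_pow_left₀ hq dist_nonneg two_ne_zero))
  have e : dist x T'.circumcenter ^ 2 - T'.circumradius ^ 2 =
      dist x T.circumcenter ^ 2 - T.circumradius ^ 2 +
        s * (T.circumradius ^ 2 - dist q T.circumcenter ^ 2) := by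
    linear_combination (T'.circumradius ^ 2 - T.circumradius ^ 2) * hw - key
  linarith

theorem finite_triangles (P : Finset Plane) :
    {T : Affine.Triangle ℝ Plane | ∀ k, T.points k ∈ P}.Finite := by
  have h := (Set.Finite.pi' fun _ : Fin 3 => P.finite_toSet).preimage
    (f := fun T : Affine.Triangle ℝ Plane => T.points)
    (fun T _ T' _ h => Affine.Simplex.ext fun i => congrFun h i)
  exact h

theorem AvoidsCollinearSpans.exists_isDelaunayTriangle {P : Finset Plane} {x : Plane}
    (hx : AvoidsCollinearSpans P x) (hconv : x ∈ convexHull ℝ (P : Set Plane)) :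
    ∃ T, IsDelaunayTriangle P T ∧ x ∈ convexHull ℝ (Set.range T.points) := by
  obtain ⟨T, ⟨hT, hxT⟩, hmax⟩ := Set.exists_max_image
    {T : Affine.Triangle ℝ Plane | (∀ k, T.points k ∈ P) ∧ x ∈ convexHull ℝ (Set.range T.points)}
    (fun T => dist x T.circumcenter ^ 2 - T.circumradius ^ 2)
    ((finite_triangles P).subset fun T hT => hT.1) (hx.exists_triangle hconv)
  refine ⟨T, ⟨hT, fun q hqP => ?_⟩, hxT⟩
  by_contra! hq
  obtain ⟨T', h1, h2, h3⟩ := hx.exists_triangle_power_lt hT hxT hqP hq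
  exact absurd (hmax T' ⟨h1, h2⟩) (not_le.2 h3)

open Filter Topology in
/-- The Delaunay triangles of a finite set of points cover its convex hull. -/
theorem exists_isDelaunayTriangle {P : Finset Plane} (hP : ¬ Collinear ℝ (P : Set Plane))
    {p : Plane} (hp : p ∈ convexHull ℝ (P : Set Plane)) :
    ∃ T, IsDelaunayTriangle P T ∧ p ∈ convexHull ℝ (Set.range T.points) := by
  obtain ⟨c, hc, hcav⟩ := exists_avoidsCollinearSpans hP
  -- A finite union of closed triangles also contains `p`, a limit of generic points.
  have hclosed : IsClosed (⋃ T ∈ {T | IsDelaunayTriangle P T},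
      convexHull ℝ (Set.range (Affine.Simplex.points T))) :=
    ((finite_triangles P).subset fun T hT => hT.1).isClosed_biUnion fun T _ =>
      (Set.finite_range _).isClosed_convexHull ℝ
  have hlim : Tendsto (AffineMap.lineMap p c : ℝ → Plane) (𝓝[>] 0) (𝓝 p) := by
    have h : Tendsto (AffineMap.lineMap p c : ℝ → Plane) (𝓝 0) (𝓝 (AffineMap.lineMap p c (0 : ℝ))) :=
      AffineMap.lineMap_continuous.tendsto 0
    rw [AffineMap.lineMap_apply_zero] at h
    exact h.mono_left nhdsWithin_le_nhds
  have hev : ∀ᶠ s in 𝓝[>] (0 : ℝ), AffineMap.lineMap p c s ∈ ⋃ T ∈ {T | IsDelaunayTriangle P T},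
      convexHull ℝ (Set.range (Affine.Simplex.points T)) := by
    filter_upwards [hcav.eventually_lineMap p, Ioo_mem_nhdsGT (zero_lt_one' ℝ)] with s hs hs01
    obtain ⟨T, hT, hsT⟩ := hs.exists_isDelaunayTriangle
      ((convex_convexHull ℝ _).lineMap_mem hp hc ⟨hs01.1.le, hs01.2.le⟩)
    exact Set.mem_iUnion₂.2 ⟨T, hT, hsT⟩
  obtain ⟨T, hT, hpT⟩ := Set.mem_iUnion₂.1 (hclosed.mem_of_tendsto hlim hev)
  exact ⟨T, hT, hpT⟩

/-! ### Crossed edges and the net property -/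

theorem crossingPoints_subset (P : Finset Plane) (T : Affine.Triangle ℝ Plane) (p : Plane)
    (i j : Fin 3) : crossingPoints P T p i j ⊆ P := fun _ hq => hq.1

theorem finite_crossingPoints (P : Finset Plane) (T : Affine.Triangle ℝ Plane) (p : Plane)
    (i j : Fin 3) : (crossingPoints P T p i j).Finite :=
  P.finite_toSet.subset (crossingPoints_subset P T p i j)

theorem IsDelaunayTriangle.exists_crossingPoints_large {P : Finset Plane}
    {T : Affine.Triangle ℝ Plane} (hT : IsDelaunayTriangle P T) {p : Plane}
    (hp : p ∈ convexHull ℝ (Set.range T.points)) :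
    ∃ i j : Fin 3, i ≠ j ∧
      ((P.card : ℝ) - 3) / 3 ≤ ((crossingPoints P T p i j).ncard : ℝ) := by
  by_contra! hcon
  have hsub : (P : Set Plane) ⊆
      Set.range T.points ∪ ⋃ k : Fin 3, crossingPoints P T p (k + 1) (k + 2) := by
    intro q hq
    by_cases hqT : q ∈ Set.range T.points
    · exact Or.inl hqT
    · obtain ⟨k, hk⟩ := T.exists_segment_inter_edge hp (hT.2 q hq)
      exact Or.inr (Set.mem_iUnion.2 ⟨k, hq, hqT, hk⟩)
  have hfin : (Set.range T.points ∪
      ⋃ k : Fin 3, crossingPoints P T p (k + 1) (k + 2)).Finite :=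
    (Set.finite_range _).union (Set.finite_iUnion fun _ => finite_crossingPoints ..)
  have h1 := (Set.ncard_le_ncard hsub hfin).trans (Set.ncard_union_le _ _)
  have h2 : (Set.range T.points).ncard = 3 := by
    rw [← Set.image_univ, Set.ncard_image_of_injective _ T.independent.injective, Set.ncard_univ]
    simp
  have h3 : (⋃ k : Fin 3, crossingPoints P T p (k + 1) (k + 2)).ncard ≤
      ∑ k : Fin 3, (crossingPoints P T p (k + 1) (k + 2)).ncard := by
    have := Finset.set_ncard_biUnion_le Finset.univ
      fun k : Fin 3 => crossingPoints P T p (k + 1) (k + 2)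
    simpa using this
  rw [Set.ncard_coe_finset, h2] at h1
  have h4 : (P.card : ℝ) ≤ 3 + ∑ k : Fin 3, ((crossingPoints P T p (k + 1) (k + 2)).ncard : ℝ) := by
    exact_mod_cast h1.trans (Nat.add_le_add_left h3 3)
  have h5 : ∀ k : Fin 3,
      ((crossingPoints P T p (k + 1) (k + 2)).ncard : ℝ) < ((P.card : ℝ) - 3) / 3 :=
    fun k => hcon (k + 1) (k + 2) (by simp)
  have h6 := Finset.sum_lt_sum_of_nonempty (s := Finset.univ) Finset.univ_nonempty
    fun k _ => h5 k
  simp only [Finset.sum_const, Finset.card_univ, Fintype.card_fin, nsmul_eq_mul] at h6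
  push_cast at h6
  linarith

/-- If a disk contains a point `q` of `P` but not the ends of an edge of a Delaunay triangle, and
the segment `pq` meets that edge, then the radical axis of the disk and the circumcircle separates
`p` from all the points of `P` in the disk. -/
theorem IsDelaunayTriangle.exists_separating_halfplane {P : Finset Plane}
    {T : Affine.Triangle ℝ Plane} (hT : IsDelaunayTriangle P T) {p q o : Plane} {r : ℝ}
    {i j : Fin 3} (hq : q ∈ crossingPoints P T p i j) (hqo : q ∈ Metric.closedBall o r)
    (hi : T.points i ∉ Metric.closedBall o r) (hj : T.points j ∉ Metric.closedBall o r)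
    (hr : 0 < r) :
    ∃ v : Plane, v ≠ 0 ∧
      ∀ z ∈ (P : Set Plane), z ∈ Metric.closedBall o r → inner ℝ v z < inner ℝ v p := by
  obtain ⟨hqP, -, x, ⟨a, b, ha, hb, hab, hx⟩, ⟨a', b', ha', hb', hab', hx'⟩⟩ := hq
  -- `2 * inner ℝ v z + k` is the difference of the powers of `z`, which vanishes on the radical
  -- axis.
  set v := T.circumcenter - o with hv
  set k := ‖o‖ ^ 2 - ‖T.circumcenter‖ ^ 2 - r ^ 2 + T.circumradius ^ 2 with hk
  have hg : ∀ z, dist z o ^ 2 - r ^ 2 - (dist z T.circumcenter ^ 2 - T.circumradius ^ 2) =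
      2 * inner ℝ v z + k := fun z => by
    linear_combination dist_sq_sub_dist_sq z o T.circumcenter
  have hin : ∀ z ∈ (P : Set Plane), z ∈ Metric.closedBall o r → 2 * inner ℝ v z + k ≤ 0 := by
    intro z hz hzo
    have h1 := pow_le_pow_left₀ dist_nonneg (Metric.mem_closedBall.1 hzo) 2
    have h2 := pow_le_pow_left₀ T.circumradius_pos.le (hT.2 z hz) 2
    linarith [hg z]
  have hout : ∀ l, T.points l ∉ Metric.closedBall o r → 0 < 2 * inner ℝ v (T.points l) + k := by
    intro l hl
    rw [Metric.mem_closedBall, not_le] at hl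
    have h1 := pow_lt_pow_left₀ hl hr.le two_ne_zero
    have h2 := hg (T.points l)
    rw [T.dist_circumcenter_eq_circumradius] at h2
    linarith
  have hxpos : 0 < 2 * inner ℝ v x + k := by
    have e : 2 * inner ℝ v x + k = a' * (2 * inner ℝ v (T.points i) + k) +
        b' * (2 * inner ℝ v (T.points j) + k) := by
      rw [← hx', inner_add_right, inner_smul_right, inner_smul_right]
      linear_combination (-k) * hab'
    have h1 := hout i hi
    have h2 := hout j hj
    rw [e]
    rcases ha'.eq_or_lt with h | h
    · have : b' = 1 := by linarith
      rw [← h, this]; linarith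
    · have := mul_pos h h1
      have := mul_nonneg hb' h2.le
      linarith
  have hp : 0 < 2 * inner ℝ v p + k := by
    have e : 2 * inner ℝ v x + k = a * (2 * inner ℝ v p + k) + b * (2 * inner ℝ v q + k) := by
      rw [← hx, inner_add_right, inner_smul_right, inner_smul_right]
      linear_combination (-k) * hab
    by_contra! hneg
    have h1 := mul_nonpos_of_nonneg_of_nonpos ha hneg
    have h2 := mul_nonpos_of_nonneg_of_nonpos hb (hin q hqP hqo)
    linarith
  -- If `v = 0`, the difference would be constant, yet it is positive at `p` and not at `q`.
  refine ⟨v, fun h0 => ?_, fun z hz hzo => by linarith [hin z hz hzo]⟩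
  have := hin q hqP hqo
  rw [h0, inner_zero_left] at this hp
  linarith

theorem IsDelaunayTriangle.isStrongNet {P : Finset Plane} {T : Affine.Triangle ℝ Plane}
    (hT : IsDelaunayTriangle P T) {p : Plane} (hp : IsCenterpoint P p) {i j : Fin 3} (hij : i ≠ j)
    (hc : ((P.card : ℝ) - 3) / 3 ≤ ((crossingPoints P T p i j).ncard : ℝ)) :
    IsStrongNet (2 / 3) P disks {T.points i, T.points j} := by
  have hsub : ({T.points i, T.points j} : Set Plane) ⊆ P := by
    rintro _ (rfl | rfl)
    · exact hT.1 _
    · exact hT.1 _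
  refine ⟨hsub, ?_⟩
  rintro _ ⟨o, r, hr, rfl⟩ hD
  by_contra hemp
  have hi : T.points i ∉ Metric.closedBall o r := fun h => hemp ⟨_, Or.inl rfl, h⟩
  have hj : T.points j ∉ Metric.closedBall o r := fun h => hemp ⟨_, Or.inr rfl, h⟩
  have hdisj : ∀ A : Set Plane, A ⊆ P → Disjoint A (Metric.closedBall o r) →
      (A.ncard : ℝ) + ((Metric.closedBall o r ∩ (P : Set Plane)).ncard : ℝ) ≤ P.card := by
    intro A hA hAd
    rw [← Set.ncard_coe_finset P]
    have hf := P.finite_toSet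
    have h1 := Set.ncard_union_eq (hAd.mono_right (Set.inter_subset_left (t := (P : Set Plane))))
      (hf.subset hA) (hf.subset Set.inter_subset_right)
    have h2 := Set.ncard_le_ncard (Set.union_subset hA
      (Set.inter_subset_right (s := Metric.closedBall o r))) hf
    rw [h1] at h2
    exact_mod_cast h2
  by_cases hcr : ∃ q ∈ crossingPoints P T p i j, q ∈ Metric.closedBall o r
  · obtain ⟨q, hq, hqo⟩ := hcr
    obtain ⟨v, hv, hsep⟩ := hT.exists_separating_halfplane hq hqo hi hj hr
    have h1 := hp v (inner ℝ v p) hv le_rfl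
    have h2 := hdisj _ (Set.inter_subset_right (s := {y | inner ℝ v p ≤ inner ℝ v y}))
      (Set.disjoint_left.2 fun z hz hzo => not_lt.2 hz.1 (hsep z hz.2 hzo))
    push_cast at h1
    linarith
  · push Not at hcr
    -- The two missed ends raise (n-3)/3 to n/3 + 1.
    have hd : Disjoint (crossingPoints P T p i j) {T.points i, T.points j} := by
      rw [Set.disjoint_left]
      rintro _ hq (rfl | rfl)
      · exact hq.2.1 ⟨_, rfl⟩
      · exact hq.2.1 ⟨_, rfl⟩
    have h1 := Set.ncard_union_eq hd (finite_crossingPoints ..)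
    rw [Set.ncard_pair (T.independent.injective.ne hij)] at h1
    have h2 := hdisj _ (Set.union_subset (crossingPoints_subset P T p i j) hsub) (by
      rw [Set.disjoint_left]
      rintro z (hz | rfl | rfl)
      · exact hcr z hz
      · exact hi
      · exact hj)
    rw [h1] at h2
    push_cast at h2
    linarith

/-! ### Collinear sets -/

theorem Finset.exists_median {α : Type*} {P : Finset α} (hP : P.Nonempty) (f : α → ℝ) :
    ∃ m ∈ P, 2 * (P.filter fun q => f q < f m).card ≤ P.card ∧
      2 * (P.filter fun q => f m < f q).card ≤ P.card := by
  classical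
  have hne : (P.filter fun m => P.card ≤ 2 * (P.filter fun q => f q ≤ f m).card).Nonempty := by
    obtain ⟨m, hm, hmax⟩ := Finset.exists_max_image P f hP
    refine ⟨m, Finset.mem_filter.2 ⟨hm, ?_⟩⟩
    rw [Finset.filter_true_of_mem hmax]
    omega
  obtain ⟨m, hm, hmin⟩ := Finset.exists_min_image _ f hne
  obtain ⟨hmP, hm⟩ := Finset.mem_filter.1 hm
  refine ⟨m, hmP, ?_, ?_⟩
  -- Otherwise the largest value strictly below `f m` would also have half of `P` weakly below it.
  · by_contra! hlt
    have hlne : (P.filter fun q => f q < f m).Nonempty := by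
      rw [← Finset.card_pos]; omega
    obtain ⟨m', hm', hmax⟩ := Finset.exists_max_image _ f hlne
    obtain ⟨hm'P, hm'lt⟩ := Finset.mem_filter.1 hm'
    have hle : (P.filter fun q => f q < f m).card ≤ (P.filter fun q => f q ≤ f m').card :=
      Finset.card_le_card fun q hq =>
        Finset.mem_filter.2 ⟨(Finset.mem_filter.1 hq).1, hmax q hq⟩
    exact absurd (hmin m' (Finset.mem_filter.2 ⟨hm'P, by omega⟩)) (not_le.2 hm'lt)
  · have h := Finset.card_filter_add_card_filter_not (s := P) (fun q => f q ≤ f m)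
    simp only [not_le] at h
    omega

theorem Collinear.exists_isStrongNet {P : Finset Plane} (hP : Collinear ℝ (P : Set Plane))
    (hcard : 2 ≤ P.card) :
    ∃ Q ⊆ P, Q.card = 2 ∧ IsStrongNet (2 / 3) P disks (Q : Set Plane) := by
  classical
  have hne : P.Nonempty := Finset.card_pos.1 (by omega)
  obtain ⟨p₀, v, hv⟩ := (collinear_iff_exists_forall_eq_smul_vadd (k := ℝ) _).1 hP
  choose! f hf using hv
  obtain ⟨m, hmP, hlo, hhi⟩ := Finset.exists_median hne f
  -- The median alone meets every large disk, by convexity; the second point is arbitrary.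
  obtain ⟨Q, hmQ, hQP, hQc⟩ := Finset.exists_subsuperset_card_eq
    (Finset.singleton_subset_iff.2 hmP) (by simp) hcard
  refine ⟨Q, hQP, hQc, by exact_mod_cast hQP, ?_⟩
  rintro _ ⟨o, r, hr, rfl⟩ hD
  refine ⟨m, hmQ (Finset.mem_singleton_self m), ?_⟩
  by_contra hmD
  have hbetween : ∀ q₁ ∈ P, ∀ q₂ ∈ P, q₁ ∈ Metric.closedBall o r → q₂ ∈ Metric.closedBall o r →
      ¬ (f q₁ ≤ f m ∧ f m ≤ f q₂) := by
    rintro q₁ h₁ q₂ h₂ hd₁ hd₂ hle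
    have hmem : f m ∈ segment ℝ (f q₁) (f q₂) := by
      rw [segment_eq_Icc (hle.1.trans hle.2)]; exact hle
    obtain ⟨a, b, ha, hb, hab, hm⟩ := hmem
    apply hmD
    have e : m = a • q₁ + b • q₂ := by
      rw [hf m hmP, hf q₁ h₁, hf q₂ h₂, ← hm]
      simp only [smul_eq_mul, vadd_eq_add]
      have hp : p₀ = (a + b) • p₀ := by rw [hab, one_smul]
      linear_combination (norm := module) hp
    rw [e]
    exact convex_closedBall o r hd₁ hd₂ ha hb hab
  have hcount : ∀ B : Finset Plane, 2 * B.card ≤ P.card →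
      ¬ (Metric.closedBall o r ∩ (P : Set Plane) ⊆ B) := by
    intro B hB hsub
    have h1 := Set.ncard_le_ncard hsub B.finite_toSet
    rw [Set.ncard_coe_finset] at h1
    have h2 : 2 * ((Metric.closedBall o r ∩ (P : Set Plane)).ncard : ℝ) ≤ P.card := by
      exact_mod_cast (Nat.mul_le_mul_left 2 h1).trans hB
    have h3 : (0 : ℝ) ≤ P.card := Nat.cast_nonneg _
    linarith
  obtain ⟨q₂, ⟨hd₂, h₂⟩, hq₂⟩ := Set.not_subset.1 (hcount _ hlo)
  obtain ⟨q₁, ⟨hd₁, h₁⟩, hq₁⟩ := Set.not_subset.1 (hcount _ hhi)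
  refine hbetween q₁ h₁ q₂ h₂ hd₁ hd₂ ⟨not_lt.1 fun h => hq₁ ?_, not_lt.1 fun h => hq₂ ?_⟩
  · exact Finset.mem_filter.2 ⟨h₁, h⟩
  · exact Finset.mem_filter.2 ⟨h₂, h⟩

/-! ### Assembly -/

theorem exists_isStrongNet_disks {P : Finset Plane} (hcard : 2 ≤ P.card) :
    ∃ Q ⊆ P, Q.card = 2 ∧ IsStrongNet (2 / 3) P disks (Q : Set Plane) := by
  classical
  by_cases hP : Collinear ℝ (P : Set Plane)
  · exact hP.exists_isStrongNet hcard
  have hne : P.Nonempty := Finset.card_pos.1 (by omega)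
  obtain ⟨p, hp⟩ := exists_isCenterpoint hne
  obtain ⟨T, hT, hpT⟩ := exists_isDelaunayTriangle hP (hp.mem_convexHull hne)
  obtain ⟨i, j, hij, hc⟩ := hT.exists_crossingPoints_large hpT
  refine ⟨{T.points i, T.points j}, ?_, Finset.card_pair (T.independent.injective.ne hij), ?_⟩
  · simp [Finset.insert_subset_iff, hT.1]
  · simpa using hT.isStrongNet hp hij hc

theorem mainTheorem7 :
    epsilonConst disks 2 ≤ 2 / 3 ∧
    ∀ P : Finset Plane, ¬ Collinear ℝ (P : Set Plane) →
      (∃ p : Plane, IsCenterpoint P p) ∧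
      ∀ p : Plane, IsCenterpoint P p →
        (∃ T : Affine.Triangle ℝ Plane, IsDelaunayTriangle P T ∧
          p ∈ convexHull ℝ (Set.range T.points)) ∧
        ∀ T : Affine.Triangle ℝ Plane, IsDelaunayTriangle P T →
          p ∈ convexHull ℝ (Set.range T.points) →
          (∃ i j : Fin 3, i ≠ j ∧
            ((P.card : ℝ) - 3) / 3 ≤ ((crossingPoints P T p i j).ncard : ℝ)) ∧
          ∀ i j : Fin 3, i ≠ j →
            ((P.card : ℝ) - 3) / 3 ≤ ((crossingPoints P T p i j).ncard : ℝ) →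
            IsStrongNet (2 / 3) P disks {T.points i, T.points j} := by
  refine ⟨csInf_le ⟨0, fun ε hε => hε.1.1⟩
    ⟨by norm_num, fun P hP => exists_isStrongNet_disks hP⟩, fun P hP => ?_⟩
  have hne : P.Nonempty := by
    rw [Finset.nonempty_iff_ne_empty]
    rintro rfl
    exact hP (by simpa using collinear_empty ℝ Plane)
  refine ⟨exists_isCenterpoint hne, fun p hp =>
    ⟨exists_isDelaunayTriangle hP (hp.mem_convexHull hne), fun T hT hpT =>
      ⟨hT.exists_crossingPoints_large hpT, fun i j hij hc => hT.isStrongNet hp hij hc⟩⟩⟩
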